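/- For a cardinal $\lambda$, say that SCH holds at $\lambda$ if $\lambda^{\mathrm{cf}(\lambda)} = 2^{\mathrm{cf}(\lambda)} + \lambda^+$, and let ESCH be the statement that there is a cardinal $\theta_0$ such that SCH holds at every infinite cardinal $\theta \ge \theta_0$. A category is well accessible if there is a regular cardinal $\mu$ such that it is $\theta$-accessible for every regular cardinal $\theta \ge \mu$; it is large if it is not equivalent to a small category. The presentability rank of an object $M$ is the least regular cardinal $\kappa$ such that $M$ is $\kappa$-presentable; the internal size of $M$ is $\lambda$ if its presentability rank is a successor cardinal $\lambda^+$, and is the presentability rank itself if the latter is not a successor. Assume ESCH, and let $\mathcal{K}$ be a large well accessible category all of whose morphisms are monomorphisms. Then $\mathcal{K}$ is LS-accessible: it is accessible and there is a cardinal $\lambda_0$ such that for every cardinal $\lambda \ge \lambda_0$, $\mathcal{K}$ has an object of presentability rank $\lambda^+$. In particular, $\mathcal{K}$ has an object of internal size $\lambda$ for every sufficiently large cardinal $\lambda$. -/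

import Mathlib

open CategoryTheory

universe w v u

namespace LSAcc

/-- The singular cardinal hypothesis holds at `κ`: `κ ^ cf κ = 2 ^ cf κ + κ⁺`. -/
def SCHAt (κ : Cardinal.{w}) : Prop :=
  κ ^ κ.ord.cof = 2 ^ κ.ord.cof + Order.succ κ

/-- The eventual singular cardinal hypothesis: SCH holds at all high-enough infinite
cardinals (of the universe `w`, which plays the role of the class of all sets). -/
def ESCH : Prop :=
  ∃ θ₀ : Cardinal.{w}, ∀ κ : Cardinal.{w}, Cardinal.aleph0 ≤ κ → θ₀ ≤ κ → SCHAt κ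

section

variable (C : Type u) [Category.{v} C]

/-- `C` is well `μ`-accessible: it is `θ`-accessible for each regular cardinal `θ ≥ μ`. -/
def IsWellCardinalAccessible (μ : Cardinal.{w}) : Prop :=
  ∀ (θ : Cardinal.{w}) [Fact θ.IsRegular], μ ≤ θ → IsCardinalAccessibleCategory C θ

/-- `C` is well accessible: it is well `μ`-accessible for some regular cardinal `μ`. -/
def IsWellAccessible : Prop :=
  ∃ μ : Cardinal.{w}, μ.IsRegular ∧ IsWellCardinalAccessible C μ

/-- `C` is large: it is not equivalent to a small category. For a locally small category
this says that the isomorphism classes of objects do not form a set. -/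
def IsLarge : Prop :=
  ¬ EssentiallySmall.{w} C

variable {C}

/-- `κ` is the presentability rank of `X`: the least regular cardinal `κ`
such that `X` is `κ`-presentable. -/
def HasPresentabilityRank (X : C) (κ : Cardinal.{w}) : Prop :=
  IsLeast {θ : Cardinal.{w} | ∃ _ : Fact θ.IsRegular, IsCardinalPresentable X θ} κ

/-- `κ` is the internal size of `X`: the presentability rank of `X` is `κ⁺`, or it is `κ`
and `κ` is not a successor cardinal. -/
def HasInternalSize (X : C) (κ : Cardinal.{w}) : Prop :=
  HasPresentabilityRank X (Order.succ κ) ∨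
    (HasPresentabilityRank X κ ∧ ∀ θ : Cardinal.{w}, κ ≠ Order.succ θ)

variable (C)

/-- `C` is LS-accessible: it is accessible and has objects of all high-enough successor
presentability ranks. -/
def IsLSAccessible : Prop :=
  IsAccessibleCategory.{w} C ∧
    ∃ κ₀ : Cardinal.{w}, ∀ κ : Cardinal.{w}, κ₀ ≤ κ →
      ∃ X : C, HasPresentabilityRank X (Order.succ κ)

/-- `C` has objects of all high-enough internal sizes. -/
def HasAllLargeInternalSizes : Prop :=
  ∃ κ₀ : Cardinal.{w}, ∀ κ : Cardinal.{w}, κ₀ ≤ κ → ∃ X : C, HasInternalSize X κ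

end

end LSAcc

/-!
Let `κ` be a sufficiently large cardinal. If `κ` is regular, an object which is not
`κ`-presentable is a `κ`-directed colimit of `κ`-presentable objects, in which one can find a
`κ`-chain of non-isomorphisms. The colimit of the chain is `κ⁺`-presentable; it is not
`κ`-presentable, as otherwise its identity would factor through a stage of the chain, and since all
morphisms are monomorphisms the chain would be constant from there on.

If `κ` is singular, fix a small generator `P` of `μ`-presentable objects and measure an object by
the number of morphisms to it from members of `P`. Some `κ⁺`-presentable object has at least `κ` of
them: otherwise every `κ⁺`-directed colimit of `κ⁺`-presentable objects would be attained at a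
stage, and every object would be `κ⁺`-presentable. On the other hand, SCH provides arbitrarily
large `χ < κ` with `χ ^ μ = χ`. A `χ⁺`-presentable object is a retract of a `μ`-directed colimit of
at most `χ` members of `P`, because every subset of size at most `χ` of a `μ`-directed order lies in
a `μ`-directed subset of size at most `χ`, so it receives at most `χ` morphisms from `P`. Hence an
object presentable below `κ` receives fewer than `κ` of them.
-/

namespace LSAcc

section CardinalArithmetic

open Cardinal Set

theorem mk_Iio_toType_lt {κ : Cardinal.{w}} (a : κ.ord.ToType) : #(Iio a) < κ := by
  simpa using mk_Iio_lt a (by simp)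

theorem exists_forall_lt_of_lt_cof {κ : Cardinal.{w}} {ι : Type w} (hι : #ι < κ.ord.cof)
    (f : ι → κ.ord.ToType) : ∃ a, ∀ i, f i < a := by
  have hcard : #(range f) < Order.cof κ.ord.ToType := by
    rw [Ordinal.cof_toType]
    exact mk_range_le.trans_lt hι
  have hcof : ¬ IsCofinal (range f) := fun h ↦ (Order.cof_le h).not_gt hcard
  obtain ⟨a, ha⟩ := not_isCofinal_iff.1 hcof
  exact ⟨a, fun i ↦ ha _ ⟨i, rfl⟩⟩

theorem power_le_self_of_lt_cof {κ μ : Cardinal.{w}} (hκ : ℵ₀ ≤ κ) (hμ : μ < κ.ord.cof)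
    (h : ∀ α < κ, α ^ μ ≤ κ) : κ ^ μ ≤ κ := by
  let g (x : Σ a : κ.ord.ToType, (μ.out → Iio a)) (i : μ.out) : κ.ord.ToType := x.2 i
  have hg : Function.Surjective g := fun f ↦ by
    obtain ⟨a, ha⟩ := exists_forall_lt_of_lt_cof (by simpa using hμ) f
    exact ⟨⟨a, fun i ↦ ⟨f i, ha i⟩⟩, rfl⟩
  calc κ ^ μ = #(μ.out → κ.ord.ToType) := by simp
    _ ≤ #(Σ a : κ.ord.ToType, (μ.out → Iio a)) := mk_le_of_surjective hg
    _ = Cardinal.sum fun a : κ.ord.ToType ↦ #(Iio a) ^ μ := by simp [mk_sigma]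
    _ ≤ Cardinal.sum fun _ : κ.ord.ToType ↦ κ :=
        sum_le_sum _ _ fun a ↦ h _ (mk_Iio_toType_lt a)
    _ = κ := by simp [mul_eq_self hκ]

theorem power_le_power_cof {κ μ : Cardinal.{w}} (hκ : ℵ₀ ≤ κ)
    (h : ∀ α < κ, α ^ μ ≤ κ) : κ ^ μ ≤ κ ^ κ.ord.cof := by
  obtain ⟨s, hs, hs'⟩ := Order.exists_cof_eq κ.ord.ToType
  have : NoMaxOrder κ.ord.ToType := noMaxOrder hκ
  -- A function into `κ` is determined by its truncations at the members of a cofinal set.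
  let truncate (f : μ.out → κ.ord.ToType) (b : s) (i : μ.out) : Iic b.1 :=
    ⟨min (f i) b, mem_Iic.2 (min_le_right _ _)⟩
  have htruncate : Function.Injective truncate := fun f₁ f₂ hf ↦ funext fun i ↦ by
    obtain ⟨b, hb, hib⟩ := hs (max (f₁ i) (f₂ i))
    have hmin : min (f₁ i) b = min (f₂ i) b :=
      congrArg Subtype.val (congr_fun (congr_fun hf ⟨b, hb⟩) i)
    rwa [min_eq_left ((le_max_left _ _).trans hib), min_eq_left ((le_max_right _ _).trans hib)]
      at hmin
  have hlt (b : κ.ord.ToType) : #(Iic b) < κ := by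
    obtain ⟨c, hbc⟩ := exists_gt b
    exact (mk_le_mk_of_subset (Iic_subset_Iio.2 hbc)).trans_lt (mk_Iio_toType_lt c)
  calc κ ^ μ = #(μ.out → κ.ord.ToType) := by simp
    _ ≤ #(∀ b : s, (μ.out → Iic b.1)) := mk_le_of_injective htruncate
    _ = Cardinal.prod fun b : s ↦ #(Iic b.1) ^ μ := by
        rw [mk_pi]
        simp only [← power_def, mk_out]
    _ ≤ Cardinal.prod fun _ : s ↦ κ := prod_le_prod _ _ fun b ↦ h _ (hlt b)
    _ = κ ^ κ.ord.cof := by rw [prod_const', hs', Ordinal.cof_toType]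

theorem power_le_succ_of_schAt {θ₀ μ : Cardinal.{w}} (hμ : ℵ₀ ≤ μ)
    (hsch : ∀ κ : Cardinal.{w}, ℵ₀ ≤ κ → θ₀ ≤ κ → SCHAt κ)
    {κ : Cardinal.{w}} (hκ : 2 ^ max θ₀ μ ≤ κ) : κ ^ μ ≤ Order.succ κ := by
  induction κ using WellFoundedLT.induction with | ind κ ih
  have hmax : ℵ₀ ≤ max θ₀ μ := hμ.trans (le_max_right _ _)
  have hmaxκ : max θ₀ μ ≤ κ := (cantor _).le.trans hκ
  have hκ₀ : ℵ₀ ≤ κ := hmax.trans hmaxκ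
  have hlt (α : Cardinal.{w}) (hα : α < κ) : α ^ μ ≤ κ := by
    by_cases h : 2 ^ max θ₀ μ ≤ α
    · exact (ih α hα h).trans (Order.succ_le_of_lt hα)
    · calc α ^ μ ≤ (2 ^ max θ₀ μ) ^ μ := power_le_power_right (not_le.1 h).le
        _ = 2 ^ max θ₀ μ := by
          rw [← power_mul, mul_eq_left hmax (le_max_right _ _) (aleph0_pos.trans_le hμ).ne']
        _ ≤ κ := hκ
  obtain hcof | hcof := lt_or_ge μ κ.ord.cof
  · exact (power_le_self_of_lt_cof hκ₀ hcof hlt).trans (Order.le_succ κ)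
  · have htwo : (2 : Cardinal.{w}) ^ κ.ord.cof ≤ Order.succ κ :=
      ((power_le_power_left two_ne_zero (hcof.trans (le_max_right _ _))).trans hκ).trans
        (Order.le_succ κ)
    calc κ ^ μ ≤ κ ^ κ.ord.cof := power_le_power_cof hκ₀ hlt
      _ = 2 ^ κ.ord.cof + Order.succ κ := hsch κ hκ₀ ((le_max_left _ _).trans hmaxκ)
      _ = Order.succ κ := add_eq_right (hκ₀.trans (Order.le_succ κ)) htwo

theorem exists_power_eq_self_of_isSingular {θ₀ μ κ α : Cardinal.{w}} (hμ : ℵ₀ ≤ μ)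
    (hsch : ∀ κ : Cardinal.{w}, ℵ₀ ≤ κ → θ₀ ≤ κ → SCHAt κ) (hκ : κ.IsSingular)
    (hκ' : 2 ^ max θ₀ μ < κ) (hα : α < κ) : ∃ χ, α ≤ χ ∧ χ < κ ∧ χ ^ μ = χ := by
  let β := max α (2 ^ max θ₀ μ)
  refine ⟨β ^ μ, ?_, ?_, ?_⟩
  · exact (le_max_left _ _).trans (self_le_power β (one_le_aleph0.trans hμ))
  · exact (power_le_succ_of_schAt hμ hsch (le_max_right _ _)).trans_lt
      (hκ.isSuccLimit.succ_lt (max_lt hα hκ'))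
  · rw [← power_mul, mul_eq_self hμ]

end CardinalArithmetic

open Limits

variable {C : Type u} [Category.{v} C]

section SubsetColimits

variable {I : Type*} [Preorder I]

/-- The restriction of a diagram indexed by a preorder to a subset of the indices. -/
abbrev restrict (D : I ⥤ C) (A : Set I) : A ⥤ C :=
  (Subtype.mono_coe (· ∈ A)).functor ⋙ D

/-- The colimit of the restriction of a diagram indexed by a preorder to a subset of the
indices. -/
noncomputable def subsetColimit (D : I ⥤ C) (A : Set I) [HasColimit (restrict D A)] : C :=
  colimit (restrict D A)

namespace subsetColimit

variable {D : I ⥤ C} {A : Set I} [HasColimit (restrict D A)] {X : C}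

/-- The coprojections of `subsetColimit D A`. -/
noncomputable def ι {i : I} (hi : i ∈ A) : D.obj i ⟶ subsetColimit D A :=
  colimit.ι (restrict D A) ⟨i, hi⟩

theorem w {i j : I} (a : i ⟶ j) (hi : i ∈ A) (hj : j ∈ A) : D.map a ≫ ι hj = ι hi :=
  colimit.w (restrict D A) (homOfLE (leOfHom a) : (⟨i, hi⟩ : A) ⟶ ⟨j, hj⟩)

theorem hom_ext {f g : subsetColimit D A ⟶ X} (h : ∀ i (hi : i ∈ A), ι hi ≫ f = ι hi ≫ g) :
    f = g :=
  colimit.hom_ext fun i ↦ h i.1 i.2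

/-- The morphism from `subsetColimit D A` induced by a compatible family of morphisms. -/
noncomputable def desc (f : ∀ i ∈ A, D.obj i ⟶ X)
    (hf : ∀ ⦃i j⦄ (a : i ⟶ j) hi hj, D.map a ≫ f j hj = f i hi) : subsetColimit D A ⟶ X :=
  colimit.desc (restrict D A)
    { pt := X
      ι.app i := f i.1 i.2
      ι.naturality i j a :=
        (hf (homOfLE (leOfHom a)) i.2 j.2).trans (Category.comp_id _).symm }

@[simp]
theorem ι_desc (f : ∀ i ∈ A, D.obj i ⟶ X)
    (hf : ∀ ⦃i j⦄ (a : i ⟶ j) hi hj, D.map a ≫ f j hj = f i hi) {i : I} (hi : i ∈ A) :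
    ι hi ≫ desc f hf = f i hi :=
  colimit.ι_desc _ _

end subsetColimit

open subsetColimit

variable {K : Type*} [Preorder K] (D : I ⥤ C) {S : K → Set I} (hS : Monotone S)
  [∀ k, HasColimit (restrict D (S k))]

/-- The diagram formed by the colimits of a diagram `D` over an increasing family of subsets of
its index preorder. -/
noncomputable abbrev subsetColimitDiagram : K ⥤ C where
  obj k := subsetColimit D (S k)
  map f := desc (fun _ hi ↦ ι (hS (leOfHom f) hi)) fun _ _ a _ _ ↦ w a _ _
  map_id k := hom_ext fun i hi ↦ by simp
  map_comp f g := hom_ext fun i hi ↦ by simp [reassoc_of% ι_desc]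

variable {D}

/-- The cocone over `subsetColimitDiagram D hS` induced by a cocone over `D`. -/
noncomputable abbrev subsetColimitCocone (c : Cocone D) : Cocone (subsetColimitDiagram D hS) where
  pt := c.pt
  ι.app k := desc (fun i _ ↦ c.ι.app i) fun _ _ a _ _ ↦ c.w a
  ι.naturality k l f := hom_ext fun i hi ↦ by simp [reassoc_of% ι_desc]

variable {hS} [IsDirectedOrder K]

theorem ι_comp_cocone_ι_app_eq (s : Cocone (subsetColimitDiagram D hS)) {k l : K} {i : I}
    (hk : i ∈ S k) (hl : i ∈ S l) : ι hk ≫ s.ι.app k = ι hl ≫ s.ι.app l := by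
  obtain ⟨m, hkm, hlm⟩ := exists_ge_ge k l
  rw [← s.w (homOfLE hkm), ← s.w (homOfLE hlm), ← Category.assoc, ← Category.assoc, ι_desc, ι_desc]

variable (hS) in
/-- A colimit over a preorder covered by a directed family of subsets is the colimit of the
colimits over these subsets. -/
noncomputable def isColimitSubsetColimitCocone (hcover : ∀ i, ∃ k, i ∈ S k)
    {c : Cocone D} (hc : IsColimit c) : IsColimit (subsetColimitCocone hS c) := by
  choose k hk using hcover
  let d (s : Cocone (subsetColimitDiagram D hS)) : Cocone D :=
    { pt := s.pt
      ι.app i := ι (hk i) ≫ s.ι.app (k i)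
      ι.naturality i j a := by
        obtain ⟨l, hil, hjl⟩ := exists_ge_ge (k i) (k j)
        rw [ι_comp_cocone_ι_app_eq s (hk i) (hS hil (hk i)),
          ι_comp_cocone_ι_app_eq s (hk j) (hS hjl (hk j)), ← Category.assoc, w]
        exact (Category.comp_id _).symm }
  exact
    { desc s := hc.desc (d s)
      fac s l := hom_ext fun i hi ↦ by
        rw [← Category.assoc, ι_desc, hc.fac]
        exact ι_comp_cocone_ι_app_eq s (hk i) hi
      uniq s m hm := hc.hom_ext fun i ↦ by
        rw [hc.fac]
        change _ = ι (hk i) ≫ s.ι.app (k i)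
        rw [← hm, ← Category.assoc, ι_desc] }

end SubsetColimits

section PresentableRetract

variable {I : Type w} [Preorder I] {D : I ⥤ C} {c : Cocone D} (κ : Cardinal.{w})
  [Fact κ.IsRegular] [IsCardinalPresentable c.pt κ]

theorem exists_retract_subsetColimit (hc : IsColimit c) {K : Type w} [Preorder K]
    [IsCardinalFiltered K κ] {S : K → Set I} (hS : Monotone S) (hcover : ∀ i, ∃ k, i ∈ S k)
    [∀ k, HasColimit (restrict D (S k))] :
    ∃ k, Nonempty (Retract c.pt (subsetColimit D (S k))) := by
  have := isFiltered_of_isCardinalFiltered K κ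
  have := IsFiltered.isDirectedOrder K
  obtain ⟨k, i, hi⟩ := IsCardinalPresentable.exists_hom_of_isColimit κ
    (isColimitSubsetColimitCocone hS hcover hc) (𝟙 c.pt)
  exact ⟨k, ⟨{ i := i, r := (subsetColimitCocone hS c).ι.app k, retract := hi }⟩⟩

theorem exists_retract_subsetColimit_hasCardinalLT (hc : IsColimit c) (μ : Cardinal.{w})
    [Fact μ.IsRegular] [HasCardinalFilteredColimits C μ]
    (hI : ∀ A : Set I, HasCardinalLT A κ →
      ∃ B : Set I, A ⊆ B ∧ IsCardinalFiltered B μ ∧ HasCardinalLT B κ) :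
    ∃ (B : Set I) (_ : HasColimit (restrict D B)), IsCardinalFiltered B μ ∧ HasCardinalLT B κ ∧
      Nonempty (Retract c.pt (subsetColimit D B)) := by
  have hκ : Cardinal.aleph0 ≤ κ := (Fact.out : κ.IsRegular).aleph0_le
  let K := {B : Set I // IsCardinalFiltered B μ ∧ HasCardinalLT B κ}
  have hK (A : Set I) (hA : HasCardinalLT A κ) : ∃ B : K, A ⊆ B.1 := by
    obtain ⟨B, hAB, hB⟩ := hI A hA
    exact ⟨⟨B, hB⟩, hAB⟩
  have : IsCardinalFiltered K κ := isCardinalFiltered_preorder _ _ fun ι B hι ↦ by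
    obtain ⟨B', hB'⟩ := hK (⋃ k, (B k).1) (hasCardinalLT_iUnion _
      ((hasCardinalLT_iff_cardinal_mk_lt _ _).2 hι) fun k ↦ (B k).2.2)
    exact ⟨B', fun k ↦ (Set.subset_iUnion _ k).trans hB'⟩
  have hcover (i : I) : ∃ B : K, i ∈ B.1 := by
    obtain ⟨B, hB⟩ := hK {i} (hasCardinalLT_of_finite _ _ hκ)
    exact ⟨B, hB rfl⟩
  have (B : K) : HasColimit (restrict D B.1) :=
    have := B.2.1
    have := HasCardinalFilteredColimits.hasColimitsOfShape (κ := μ) C B.1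
    inferInstance
  obtain ⟨B, hB⟩ := exists_retract_subsetColimit κ hc (Subtype.mono_coe _) hcover
  exact ⟨B.1, inferInstance, B.2.1, B.2.2, hB⟩

end PresentableRetract

section GeneralizedElements

open Cardinal

/-- The generalized elements of `X` of shape `P`: the morphisms to `X` from the objects satisfying
`P`, which play the role of the elements of the underlying set of `X`. -/
abbrev GenElement (P : ObjectProperty C) (X : C) : Type (max u v) :=
  Σ A : Subtype P, (A.1 ⟶ X)

variable (P : ObjectProperty C) {X Y : C}

/-- The map induced by a morphism on generalized elements. -/
abbrev GenElement.map (f : X ⟶ Y) (x : GenElement P X) : GenElement P Y :=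
  ⟨x.1, x.2 ≫ f⟩

variable {P}

theorem GenElement.map_surjective_of_isSplitEpi (f : X ⟶ Y) [IsSplitEpi f] :
    Function.Surjective (GenElement.map P f) :=
  fun y ↦ ⟨⟨y.1, y.2 ≫ section_ f⟩, by simp [GenElement.map]⟩

theorem isIso_of_genElement_map_surjective {μ : Cardinal.{w}} [Fact μ.IsRegular]
    (hP : P.IsCardinalFilteredGenerator μ) (f : X ⟶ Y) [Mono f]
    (hf : Function.Surjective (GenElement.map P f)) : IsIso f :=
  hP.isStrongGenerator.isIso_of_mono f fun A hA y ↦ by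
    obtain ⟨⟨B, x⟩, h⟩ := hf ⟨⟨A, hA⟩, y⟩
    obtain ⟨rfl, h⟩ := Sigma.mk.inj h
    exact ⟨x, eq_of_heq h⟩

variable {κ : Cardinal.{w}} [Fact κ.IsRegular]

theorem exists_genElement_map_ι_app_eq (hP : P ≤ isCardinalPresentable C κ) {J : Type w}
    [SmallCategory J] [IsCardinalFiltered J κ] {D : J ⥤ C} {c : Cocone D} (hc : IsColimit c)
    (x : GenElement P c.pt) : ∃ j y, GenElement.map P (c.ι.app j) y = x := by
  have : IsCardinalPresentable x.1.1 κ := hP _ x.1.2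
  obtain ⟨j, y, hy⟩ := IsCardinalPresentable.exists_hom_of_isColimit κ hc x.2
  exact ⟨j, ⟨x.1, y⟩, congrArg (Sigma.mk x.1) hy⟩

theorem exists_forall_genElement_map_ι_app_eq (hP : P ≤ isCardinalPresentable C κ) {J : Type w}
    [SmallCategory J] [IsCardinalFiltered J κ] {D : J ⥤ C} {c : Cocone D} (hc : IsColimit c)
    {W : Type*} (hW : HasCardinalLT W κ) (x : W → GenElement P c.pt) :
    ∃ j, ∀ i, ∃ y, GenElement.map P (c.ι.app j) y = x i := by
  choose j y hy using fun i ↦ exists_genElement_map_ι_app_eq hP hc (x i)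
  refine ⟨IsCardinalFiltered.max j hW, fun i ↦
    ⟨GenElement.map P (D.map (IsCardinalFiltered.toMax j hW i)) (y i), ?_⟩⟩
  rw [← hy i, GenElement.map, GenElement.map, Category.assoc, c.w]

theorem hasCardinalLT_genElement_of_isColimit {μ : Cardinal.{w}} [Fact μ.IsRegular]
    (hP : P ≤ isCardinalPresentable C μ) {J : Type w} [SmallCategory J] [IsCardinalFiltered J μ]
    {D : J ⥤ C} {c : Cocone D} (hc : IsColimit c) (hJ : HasCardinalLT J κ)
    (hD : ∀ j, HasCardinalLT (GenElement P (D.obj j)) κ) :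
    HasCardinalLT (GenElement P c.pt) κ :=
  (hasCardinalLT_sigma _ κ hJ hD).of_surjective (fun x ↦ GenElement.map P (c.ι.app x.1) x.2)
    fun x ↦ by
      obtain ⟨j, y, rfl⟩ := exists_genElement_map_ι_app_eq hP hc x
      exact ⟨⟨j, y⟩, rfl⟩

theorem hasCardinalLT_genElement_of_isColimit_of_lt (hP : P ≤ isCardinalPresentable C κ)
    {J : Type w} [SmallCategory J] [IsCardinalFiltered J κ] {D : J ⥤ C} {c : Cocone D}
    (hc : IsColimit c) {α : Cardinal.{w}} (hα : α < κ)
    (hD : ∀ j, HasCardinalLT (GenElement P (D.obj j)) α) :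
    HasCardinalLT (GenElement P c.pt) α := by
  by_contra hcard
  obtain ⟨x⟩ : Nonempty (α.out ↪ GenElement P c.pt) := by
    rw [← lift_mk_le', mk_out]
    exact not_lt.1 hcard
  obtain ⟨j, hj⟩ := exists_forall_genElement_map_ι_app_eq hP hc (W := α.out)
    (by simpa [hasCardinalLT_iff_cardinal_mk_lt] using hα) x
  choose y hy using hj
  have hy_inj : Function.Injective y := fun i i' h ↦ x.injective (by rw [← hy i, ← hy i', h])
  have hlt := (hD j).of_injective y hy_inj
  simp [hasCardinalLT_iff_cardinal_mk_lt] at hlt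

theorem exists_forall_hasCardinalLT_genElement (P : ObjectProperty C) [ObjectProperty.Small.{w} P]
    [LocallySmall.{w} C] : ∃ ν : Cardinal.{w}, ∀ A, P A → HasCardinalLT (GenElement P A) ν := by
  obtain ⟨ν, -, hν⟩ := HasCardinalLT.exists_regular_cardinal.{w}
    (Σ A : Subtype P, GenElement P A.1)
  exact ⟨ν, fun A hA ↦ hν.of_injective (fun x ↦ ⟨⟨A, hA⟩, x⟩) fun _ _ h ↦ by simpa using h⟩

end GeneralizedElements

section SingularCase

open Cardinal Order

theorem exists_isCardinalFiltered_superset {μ χ : Cardinal.{w}} [hμ : Fact μ.IsRegular]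
    [Fact (succ χ).IsRegular] (hμχ : μ ≤ χ) (hχ : χ ^ μ = χ) {I : Type w} [PartialOrder I]
    [IsCardinalFiltered I μ] (A : Set I) (hA : HasCardinalLT A (succ χ)) :
    ∃ B : Set I, A ⊆ B ∧ IsCardinalFiltered B μ ∧ HasCardinalLT B (succ χ) := by
  refine SharplyLT.exists_isCardinalFiltered_set_of_exists_cofinal
    (lt_succ_of_le hμχ) (fun X hX ↦ ⟨Set.univ, ?_, IsCofinal.univ⟩) A hA
  rw [hasCardinalLT_iff_cardinal_mk_lt, lt_succ_iff] at hX ⊢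
  rw [mk_univ]
  calc #{t : Set X | HasCardinalLT t μ}
    _ ≤ #{t : Set X // #t ≤ μ} := mk_subtype_le_of_subset fun t ht ↦
      ((hasCardinalLT_iff_cardinal_mk_lt _ _).1 ht).le
    _ ≤ max #X ℵ₀ ^ μ := mk_bounded_set_le X μ
    _ ≤ χ ^ μ := power_le_power_right (max_le hX (hμ.out.aleph0_le.trans hμχ))
    _ = χ := hχ

variable {P : ObjectProperty C} {μ : Cardinal.{w}} [Fact μ.IsRegular]

theorem hasCardinalLT_genElement_of_isCardinalPresentable [HasCardinalFilteredColimits C μ]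
    (hP : P.IsCardinalFilteredGenerator μ) {χ : Cardinal.{w}} [Fact (succ χ).IsRegular]
    (hμχ : μ ≤ χ) (hχ : χ ^ μ = χ) (hPχ : ∀ A, P A → HasCardinalLT (GenElement P A) (succ χ))
    (N : C) [IsCardinalPresentable N (succ χ)] : HasCardinalLT (GenElement P N) (succ χ) := by
  obtain ⟨J, _, _, ⟨q⟩⟩ := hP.exists_colimitsOfShape N
  obtain ⟨I, _, _, G, _⟩ := IsCardinalFiltered.exists_cardinal_directed J μ
  let p := q.reindex G
  obtain ⟨B, _, _, hB, ⟨h⟩⟩ := exists_retract_subsetColimit_hasCardinalLT (succ χ) p.isColimit μ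
    (exists_isCardinalFiltered_superset hμχ hχ)
  have hcolim : HasCardinalLT (GenElement P (subsetColimit p.diag B)) (succ χ) :=
    hasCardinalLT_genElement_of_isColimit hP.le_isCardinalPresentable
      (colimit.isColimit (restrict p.diag B)) hB fun i ↦ hPχ _ (p.prop_diag_obj i.1)
  exact hcolim.of_surjective _ (GenElement.map_surjective_of_isSplitEpi h.r)

theorem exists_isCardinalPresentable_not_hasCardinalLT_genElement
    (hmono : ∀ {X Y : C} (f : X ⟶ Y), Mono f) (hP : P.IsCardinalFilteredGenerator μ)
    {κ : Cardinal.{w}} [Fact κ.IsRegular] [IsCardinalAccessibleCategory C κ] (hμκ : μ ≤ κ)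
    {M : C} (hM : ¬ IsCardinalPresentable M κ) {α : Cardinal.{w}} (hα : α < κ) :
    ∃ N : C, IsCardinalPresentable N κ ∧ ¬ HasCardinalLT (GenElement P N) α := by
  have hPκ : P ≤ isCardinalPresentable C κ :=
    hP.le_isCardinalPresentable.trans (isCardinalPresentable_monotone C hμκ)
  obtain ⟨R, _, hR⟩ := HasCardinalFilteredGenerator.exists_generator C κ
  obtain ⟨J, _, _, ⟨p⟩⟩ := hR.exists_colimitsOfShape M
  have hp (j : J) : IsCardinalPresentable (p.diag.obj j) κ :=
    hR.le_isCardinalPresentable _ (p.prop_diag_obj j)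
  by_contra! hsmall
  have hMα : HasCardinalLT (GenElement P M) α :=
    hasCardinalLT_genElement_of_isColimit_of_lt hPκ p.isColimit hα fun j ↦ hsmall _ (hp j)
  obtain ⟨j, hj⟩ :=
    exists_forall_genElement_map_ι_app_eq hPκ p.isColimit (hMα.of_le hα.le) id
  have := hmono (p.ι.app j)
  have : IsIso (p.ι.app j) := isIso_of_genElement_map_surjective hP _ hj
  exact hM (isCardinalPresentable_of_iso (asIso (p.ι.app j)) κ)

end SingularCase

section RegularCase

open Cardinal Order

theorem isCardinalPresentable_of_isColimit_of_mk_le [LocallySmall.{w} C] {κ : Cardinal.{w}}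
    [Fact (succ κ).IsRegular] {T : Type w} [Preorder T] (hT : #T ≤ κ) {F : T ⥤ C} {c : Cocone F}
    (hc : IsColimit c) [∀ t, IsCardinalPresentable (F.obj t) (succ κ)] :
    IsCardinalPresentable c.pt (succ κ) := by
  refine isCardinalPresentable_of_isColimit c hc (succ κ) ?_
  have hT' : HasCardinalLT T (succ κ) :=
    (hasCardinalLT_iff_cardinal_mk_lt _ _).2 (lt_succ_of_le hT)
  refine (hasCardinalLT_prod (Fact.out : (succ κ).IsRegular).aleph0_le hT' hT').of_injective
    (fun a : Arrow T ↦ (a.left, a.right)) ?_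
  rintro ⟨s, t, a⟩ ⟨s', t', a'⟩ h
  obtain ⟨rfl, rfl⟩ := Prod.mk.inj h
  obtain rfl : a = a' := Subsingleton.elim _ _
  rfl

theorem isIso_of_isIso_comp_of_mono {X Y Z : C} (f : X ⟶ Y) (g : Y ⟶ Z) [Mono g]
    [IsIso (f ≫ g)] : IsIso f :=
  ⟨g ≫ inv (f ≫ g), by simp [← Category.assoc], by simp [← cancel_mono g]⟩

variable {κ : Cardinal.{w}} [Fact κ.IsRegular]

theorem exists_forall_lt_apply_le {I : Type*} [Preorder I] [IsCardinalFiltered I κ]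
    (next : I → I) : ∃ b : κ.ord.ToType → I, ∀ s t, s < t → next (b s) ≤ b t := by
  have hIio (t : κ.ord.ToType) : HasCardinalLT (Set.Iio t) κ :=
    (hasCardinalLT_iff_cardinal_mk_lt _ _).2 (mk_Iio_toType_lt t)
  let b : κ.ord.ToType → I := wellFounded_lt.fix fun t b' ↦
    IsCardinalFiltered.max (fun s : Set.Iio t ↦ next (b' s.1 s.2)) (hIio t)
  have hb (t : κ.ord.ToType) :
      b t = IsCardinalFiltered.max (fun s : Set.Iio t ↦ next (b s.1)) (hIio t) :=
    WellFounded.fix_eq _ _ _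
  refine ⟨b, fun s t hst ↦ ?_⟩
  rw [hb t]
  exact leOfHom (IsCardinalFiltered.toMax (fun s : Set.Iio t ↦ next (b s.1)) (hIio t) ⟨s, hst⟩)

theorem exists_not_isIso_map {I : Type w} [Preorder I] [IsCardinalFiltered I κ] {D : I ⥤ C}
    {c : Cocone D} (hc : IsColimit c) (hD : ∀ i, IsCardinalPresentable (D.obj i) κ)
    (hM : ¬ IsCardinalPresentable c.pt κ) (i : I) : ∃ (j : I) (a : i ⟶ j), ¬ IsIso (D.map a) := by
  by_contra! h
  have := isFiltered_of_isCardinalFiltered I κ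
  have hconst : D.IsEventuallyConstantFrom i := h
  have := hconst.isIso_ι_of_isColimit hc
  exact hM (isCardinalPresentable_of_iso (asIso (c.ι.app i)) κ)

theorem exists_forall_hom_isIso_ι_app (hmono : ∀ {X Y : C} (f : X ⟶ Y), Mono f) {J : Type w}
    [SmallCategory J] [IsCardinalFiltered J κ] {D : J ⥤ C} {c : Cocone D} (hc : IsColimit c)
    [IsCardinalPresentable c.pt κ] : ∃ j, ∀ j' (_ : j ⟶ j'), IsIso (c.ι.app j') := by
  obtain ⟨j, r, hr⟩ := IsCardinalPresentable.exists_hom_of_isColimit κ hc (𝟙 c.pt)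
  refine ⟨j, fun j' a ↦ ?_⟩
  have := hmono (c.ι.app j')
  have : IsSplitEpi (c.ι.app j') := ⟨⟨⟨r ≫ D.map a, by simpa using hr⟩⟩⟩
  exact isIso_of_mono_of_isSplitEpi _

theorem exists_lt_isIso_map (hmono : ∀ {X Y : C} (f : X ⟶ Y), Mono f) {T : Type w} [Preorder T]
    [NoMaxOrder T] [IsCardinalFiltered T κ] {D : T ⥤ C} {c : Cocone D} (hc : IsColimit c)
    [IsCardinalPresentable c.pt κ] : ∃ (s t : T) (h : s < t), IsIso (D.map (homOfLE h.le)) := by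
  obtain ⟨s, hs⟩ := exists_forall_hom_isIso_ι_app hmono hc (κ := κ)
  obtain ⟨t, hst⟩ := exists_gt s
  have := hs s (𝟙 s)
  have := hs t (homOfLE hst.le)
  have : IsIso (D.map (homOfLE hst.le) ≫ c.ι.app t) := by rwa [c.w]
  exact ⟨s, t, hst, IsIso.of_isIso_comp_right _ (c.ι.app t)⟩

theorem exists_isCardinalPresentable_succ_of_isRegular
    (hmono : ∀ {X Y : C} (f : X ⟶ Y), Mono f) [Fact (succ κ).IsRegular]
    [IsCardinalAccessibleCategory C κ] {M : C} (hM : ¬ IsCardinalPresentable M κ) :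
    ∃ N : C, IsCardinalPresentable N (succ κ) ∧ ¬ IsCardinalPresentable N κ := by
  obtain ⟨P, _, hP⟩ := HasCardinalFilteredGenerator.exists_generator C κ
  obtain ⟨J, _, _, ⟨q⟩⟩ := hP.exists_colimitsOfShape M
  obtain ⟨I, _, _, G, _⟩ := IsCardinalFiltered.exists_cardinal_directed J κ
  let p := q.reindex G
  have hp (i : I) : IsCardinalPresentable (p.diag.obj i) κ :=
    hP.le_isCardinalPresentable _ (p.prop_diag_obj i)
  choose next toNext hnext using exists_not_isIso_map p.isColimit hp hM
  obtain ⟨b, hb⟩ := exists_forall_lt_apply_le (κ := κ) next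
  have hb_mono : Monotone b := fun s t hst ↦ by
    obtain rfl | hst := hst.eq_or_lt
    · rfl
    · exact (leOfHom (toNext (b s))).trans (hb s t hst)
  let F : κ.ord.ToType ⥤ C := hb_mono.functor ⋙ p.diag
  have hF (t : κ.ord.ToType) : IsCardinalPresentable (F.obj t) (succ κ) :=
    isCardinalPresentable_monotone C (le_succ κ) _ (hp (b t))
  have := HasCardinalFilteredColimits.hasColimitsOfShape (κ := κ) C κ.ord.ToType
  refine ⟨colimit F, isCardinalPresentable_of_isColimit_of_mk_le (by simp) (colimit.isColimit F),
    fun hN ↦ ?_⟩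
  have : NoMaxOrder κ.ord.ToType := noMaxOrder (Fact.out : κ.IsRegular).aleph0_le
  have : IsCardinalPresentable (colimit.cocone F).pt κ := hN
  obtain ⟨s, t, hst, hiso⟩ := exists_lt_isIso_map hmono (colimit.isColimit F) (κ := κ)
  have := hmono (p.diag.map (homOfLE (hb s t hst)))
  have : IsIso (p.diag.map (toNext (b s)) ≫ p.diag.map (homOfLE (hb s t hst))) := by
    rwa [← p.diag.map_comp]
  exact hnext (b s) (isIso_of_isIso_comp_of_mono _ (p.diag.map (homOfLE (hb s t hst))))

end RegularCase

section PresentabilityRanks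

open Cardinal Order

theorem exists_not_isCardinalPresentable (hlarge : IsLarge.{w} C) (κ : Cardinal.{w})
    [Fact κ.IsRegular] [IsCardinalAccessibleCategory C κ] :
    ∃ M : C, ¬ IsCardinalPresentable M κ := by
  by_contra! hall
  refine hlarge ((essentiallySmall_iff_objectPropertyEssentiallySmall_top C).2 ?_)
  exact ObjectProperty.EssentiallySmall.of_le (Q := isCardinalPresentable C κ) fun X _ ↦ hall X

theorem hasPresentabilityRank_succ {κ : Cardinal.{w}} [hκ : Fact (succ κ).IsRegular] {X : C}
    (hX : IsCardinalPresentable X (succ κ))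
    (hX' : ∀ θ [Fact θ.IsRegular], θ ≤ κ → ¬ IsCardinalPresentable X θ) :
    HasPresentabilityRank X (succ κ) :=
  ⟨⟨hκ, hX⟩, fun θ ⟨_, hθ⟩ ↦ succ_le_of_lt (not_le.1 fun hθκ ↦ hX' θ hθκ hθ)⟩

theorem exists_hasPresentabilityRank_succ_of_isRegular
    (hmono : ∀ {X Y : C} (f : X ⟶ Y), Mono f) (hlarge : IsLarge.{w} C) {κ : Cardinal.{w}}
    [hκ : Fact κ.IsRegular] [IsCardinalAccessibleCategory C κ] :
    ∃ X : C, HasPresentabilityRank X (succ κ) := by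
  have : Fact (succ κ).IsRegular := ⟨isRegular_succ hκ.out.aleph0_le⟩
  obtain ⟨M, hM⟩ := exists_not_isCardinalPresentable hlarge κ
  obtain ⟨X, hX, hX'⟩ := exists_isCardinalPresentable_succ_of_isRegular hmono hM
  exact ⟨X, hasPresentabilityRank_succ hX fun θ _ hθ _ ↦ hX' (isCardinalPresentable_of_le X hθ)⟩

variable {P : ObjectProperty C} {μ ν θ₀ κ : Cardinal.{w}} [hμ : Fact μ.IsRegular]

theorem hasCardinalLT_genElement_of_isSingular [HasCardinalFilteredColimits C μ]
    (hsch : ∀ κ : Cardinal.{w}, ℵ₀ ≤ κ → θ₀ ≤ κ → SCHAt κ)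
    (hP : P.IsCardinalFilteredGenerator μ) (hPν : ∀ A, P A → HasCardinalLT (GenElement P A) ν)
    (hκ : κ.IsSingular) (hμκ : 2 ^ max θ₀ μ < κ) (hνκ : ν < κ)
    {θ : Cardinal.{w}} [Fact θ.IsRegular] (hθκ : θ < κ) (N : C) [IsCardinalPresentable N θ] :
    HasCardinalLT (GenElement P N) κ := by
  have hμκ' : μ < κ := ((le_max_right θ₀ μ).trans_lt (cantor _)).trans hμκ
  obtain ⟨χ, hle, hχκ, hχ⟩ := exists_power_eq_self_of_isSingular hμ.out.aleph0_le hsch hκ hμκ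
    (max_lt hθκ (max_lt hμκ' hνκ))
  obtain ⟨hθχ, hμχ, hνχ⟩ : θ ≤ χ ∧ μ ≤ χ ∧ ν ≤ χ := by simpa only [max_le_iff] using hle
  have : Fact (succ χ).IsRegular := ⟨isRegular_succ (hμ.out.aleph0_le.trans hμχ)⟩
  have : IsCardinalPresentable N (succ χ) :=
    isCardinalPresentable_of_le N (hθχ.trans (le_succ χ))
  exact (hasCardinalLT_genElement_of_isCardinalPresentable hP hμχ hχ
    (fun A hA ↦ (hPν A hA).of_le (hνχ.trans (le_succ χ))) N).of_le (succ_le_of_lt hχκ)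

theorem exists_hasPresentabilityRank_succ_of_isSingular
    (hmono : ∀ {X Y : C} (f : X ⟶ Y), Mono f) (hlarge : IsLarge.{w} C)
    [HasCardinalFilteredColimits C μ] (hsch : ∀ κ : Cardinal.{w}, ℵ₀ ≤ κ → θ₀ ≤ κ → SCHAt κ)
    (hP : P.IsCardinalFilteredGenerator μ) (hPν : ∀ A, P A → HasCardinalLT (GenElement P A) ν)
    (hκ : κ.IsSingular) (hμκ : 2 ^ max θ₀ μ < κ) (hνκ : ν < κ)
    [Fact (succ κ).IsRegular] [IsCardinalAccessibleCategory C (succ κ)] :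
    ∃ X : C, HasPresentabilityRank X (succ κ) := by
  have hμκ' : μ ≤ succ κ :=
    ((le_max_right θ₀ μ).trans (cantor _).le).trans (hμκ.le.trans (le_succ κ))
  obtain ⟨M, hM⟩ := exists_not_isCardinalPresentable hlarge (succ κ)
  obtain ⟨X, hX, hX'⟩ := exists_isCardinalPresentable_not_hasCardinalLT_genElement hmono hP
    hμκ' hM (lt_succ κ)
  refine ⟨X, hasPresentabilityRank_succ hX fun θ hθ hθκ _ ↦ hX' ?_⟩
  have hne : θ ≠ κ := fun h ↦ hκ.not_isRegular (h ▸ hθ.out)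
  exact hasCardinalLT_genElement_of_isSingular hsch hP hPν hκ hμκ hνκ (hθκ.lt_of_ne hne) X

theorem exists_forall_exists_hasPresentabilityRank_succ (hESCH : ESCH.{w})
    (hmono : ∀ {X Y : C} (f : X ⟶ Y), Mono f) (hlarge : IsLarge.{w} C)
    (hwell : IsWellAccessible.{w} C) :
    ∃ κ₀ : Cardinal.{w}, ∀ κ, κ₀ ≤ κ → ∃ X : C, HasPresentabilityRank X (succ κ) := by
  obtain ⟨θ₀, hsch⟩ := hESCH
  obtain ⟨μ, hμ, hacc⟩ := hwell
  have : Fact μ.IsRegular := ⟨hμ⟩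
  have := hacc μ le_rfl
  obtain ⟨P, _, hP⟩ := HasCardinalFilteredGenerator.exists_small_generator C μ
  obtain ⟨ν, hPν⟩ := exists_forall_hasCardinalLT_genElement.{w} P
  refine ⟨succ (max ν (2 ^ max θ₀ μ)), fun κ hκ ↦ ?_⟩
  obtain ⟨hνκ, hμκ⟩ := max_lt_iff.1 (succ_le_iff.1 hκ)
  have hμκ' : μ ≤ κ := ((le_max_right θ₀ μ).trans (cantor _).le).trans hμκ.le
  have hκ₀ : ℵ₀ ≤ κ := hμ.aleph0_le.trans hμκ'
  obtain hreg | hsing := isRegular_or_isSingular hκ₀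
  · have : Fact κ.IsRegular := ⟨hreg⟩
    have := hacc κ hμκ'
    exact exists_hasPresentabilityRank_succ_of_isRegular hmono hlarge
  · have : Fact (succ κ).IsRegular := ⟨isRegular_succ hκ₀⟩
    have := hacc (succ κ) (hμκ'.trans (le_succ κ))
    exact exists_hasPresentabilityRank_succ_of_isSingular hmono hlarge hsch hP hPν hsing hμκ hνκ

theorem IsWellAccessible.isAccessibleCategory (h : IsWellAccessible.{w} C) :
    IsAccessibleCategory.{w} C := by
  obtain ⟨μ, hμ, hacc⟩ := h
  have : Fact μ.IsRegular := ⟨hμ⟩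
  exact ⟨μ, inferInstance, hacc μ le_rfl⟩

end PresentabilityRanks

end LSAcc

theorem mainTheorem4 (hESCH : LSAcc.ESCH.{w})
    (C : Type u) [Category.{v} C]
    (hmono : ∀ {X Y : C} (f : X ⟶ Y), Mono f)
    (hlarge : LSAcc.IsLarge.{w} C)
    (hwell : LSAcc.IsWellAccessible.{w} C) :
    LSAcc.IsLSAccessible.{w} C ∧ LSAcc.HasAllLargeInternalSizes.{w} C := by
  obtain ⟨κ₀, h⟩ :=
    LSAcc.exists_forall_exists_hasPresentabilityRank_succ hESCH hmono hlarge hwell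
  refine ⟨⟨hwell.isAccessibleCategory, κ₀, h⟩, κ₀, fun κ hκ ↦ ?_⟩
  obtain ⟨X, hX⟩ := h κ hκ
  exact ⟨X, Or.inl hX⟩
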